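/- Fix $\mathfrak a,\beta,L>0$, $\rho<1$, $x\in[0,1]$. For $b>0$ let $\langle b\rangle$ be the largest nonnegative integer strictly less than $b$, and let $\mathcal H(M,b)$ be the class of functions $g$ that are $\langle b\rangle$ times continuously differentiable on $[0,1]$ (one-sided derivatives at the end points) with $|g^{(\langle b\rangle)}(y)-g^{(\langle b\rangle)}(z)|\le M|y-z|^{b-\langle b\rangle}$ for all $y,z\in[0,1]$. Innovations. Let $(\varepsilon_k)_{k\in\mathbb Z}$ be iid real random variables with distribution function $F_\varepsilon$ such that (i) for some $\mathfrak c,\mathfrak c_g,\delta>0$, $|F_\varepsilon(y)-\mathfrak c\,y^{\mathfrak a}|\le \mathfrak c_g\,y^{\mathfrak a+\delta}$ for all sufficiently small $y>0$ (so $\varepsilon_k>0$ almost surely), and $F_\varepsilon\in\mathcal H(L_\varepsilon,\beta_\varepsilon)$ for some $L_\varepsilon,\beta_\varepsilon>0$; (ii) for some $\tilde\delta>0$, $\mathbb E\,\varepsilon_0^p<\infty$ for all $0\le p\le\max\{1,2\mathfrak a+\tilde\delta\}$. Process. For $f:[0,1]\to[0,\rho]$, extended to $\mathbb R$ by $f(u)=f(0)$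 for $u<0$ and $f(u)=f(1)$ for $u>1$, and $N\ge1$, let $$X_k=\sum_{i=0}^\infty\Big(\prod_{l=0}^{i-1}f\big(\tfrac{k-l}N\big)\Big)\varepsilon_{k-i},\qquad k\in\mathbb Z,$$ which is the causal solution of $X_k=f(k/N)X_{k-1}+\varepsilon_k$; put $Y_k=X_k/X_{k-1}$ for $1\le k\le N$. Write $\mathbb P_f$ for the probability in this model. Estimator. For $h>0$ let $n=n(h,x)=|\{1\le k\le N:\ k/N\in[x-h,x+h]\}|$. Let $d\ge\langle\beta\rangle$ be a fixed integer (for instance $d=\lfloor\beta\rfloor+1$). Let $\hat f_h(x)=\hat b_0$, where $(\hat b_i)_{i=0}^d$ is any solution of the linear program: maximize $\sum_{|k/N-x|\le h}p(k/N)$ over the polynomials $p(y)=\sum_{i=0}^d b_i(y-x)^i$ subject to $p(k/N)\le Y_k$ for all $1\le k\le N$ with $|k/N-x|\le h$. (A solution always exists; it need not be unique.) Claim. There are constants $c_1,c_2,c_3,\nu>0$, not depending on $N$, $h$, $v$, $f$ or the choice of the solution, such that for all $N\ge1$, all $h>0$ and all $0\le v\le n^\nu$, $$\sup_{f}\ \mathbb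 P_f\Big(\big|\hat f_h(x)-f(x)\big|\ge c_1h^\beta+c_2\,n^{-1/\mathfrak a}\,v\Big)\le c_3\,e^{-v^{\mathfrak a}},$$ where $n^{-1/\mathfrak a}v:=0$ if $n=0$, and the supremum is over all $f\in\mathcal H(L,\beta)$ with $0\le f\le\rho$ on $[0,1]$. The bound holds for every choice of the solutions, measurable or not (with outer probability in the latter case). -/

import Mathlib

open MeasureTheory ProbabilityTheory Filter Topology

noncomputable section

/-- The largest nonnegative integer strictly less than `β` (for `β > 0`). -/
def strictFloor (β : ℝ) : ℕ := ⌈β⌉₊ - 1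

theorem isGreatest_strictFloor {β : ℝ} (hβ : 0 < β) :
    IsGreatest {m : ℕ | (m : ℝ) < β} (strictFloor β) := by
  have h0 : 0 < ⌈β⌉₊ := Nat.ceil_pos.mpr hβ
  constructor
  · exact Nat.lt_ceil.mp (show ⌈β⌉₊ - 1 < ⌈β⌉₊ by omega)
  · intro m hm
    have : m < ⌈β⌉₊ := Nat.lt_ceil.mpr hm
    unfold strictFloor
    omega

/-- The Hölder class `H(L, β)` of functions on `[0,1]`: only the values on `[0,1]` matter,
derivatives at the end points are one-sided. -/
def HolderClass (L β : ℝ) (f : ℝ → ℝ) : Prop :=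
  ContDiffOn ℝ (strictFloor β : ℕ) f (Set.Icc 0 1) ∧
    ∀ y ∈ Set.Icc (0 : ℝ) 1, ∀ z ∈ Set.Icc (0 : ℝ) 1,
      |iteratedDerivWithin (strictFloor β) f (Set.Icc 0 1) y -
        iteratedDerivWithin (strictFloor β) f (Set.Icc 0 1) z| ≤
          L * |y - z| ^ (β - (strictFloor β : ℝ))

/-- The assumptions on the innovations: iid, with distribution function
`F(y) = c y ^ a + O(y ^ (a + δ))` as `y ↓ 0`, with `F` in some Hölder class, and with finite moments
of all orders `p ≤ max 1 (2 a + δ')` for some `δ' > 0`.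
The decay condition forces `F(0) = 0`, so the innovations are almost surely positive. -/
structure InnovationAssumption {Ω : Type*} [MeasurableSpace Ω] (P : Measure Ω)
    (ε : ℤ → Ω → ℝ) (a : ℝ) : Prop where
  measurable : ∀ k, Measurable (ε k)
  indep : iIndepFun ε P
  ident : ∀ k, IdentDistrib (ε k) (ε 0) P P
  shape_pos : 0 < a
  decay : ∃ c cg δ : ℝ, 0 < c ∧ 0 < cg ∧ 0 < δ ∧
    ∀ᶠ y in 𝓝[>] (0 : ℝ), |cdf (P.map (ε 0)) y - c * y ^ a| ≤ cg * y ^ (a + δ)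
  holder : ∃ Lε βε : ℝ, 0 < Lε ∧ 0 < βε ∧ HolderClass Lε βε (fun y => cdf (P.map (ε 0)) y)
  moments : ∃ δ' : ℝ, 0 < δ' ∧ ∀ p : ℝ, 0 ≤ p → p ≤ max 1 (2 * a + δ') →
    Integrable (fun ω => (ε 0 ω) ^ p) P

/-- The extension of a function on `[0,1]` to the real line by its boundary values. -/
def constExtend (f : ℝ → ℝ) (u : ℝ) : ℝ := f (max 0 (min u 1))

/-- The time-varying autoregressive process `X_k = f(k/N) X_{k-1} + ε_k`, `k ∈ ℤ`, with `f` extended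
by its boundary values, in its causal form
`X_k = ∑_{i ≥ 0} (∏_{l < i} f((k - l)/N)) ε_{k-i}`. -/
def tvAR {Ω : Type*} (N : ℕ) (f : ℝ → ℝ) (ε : ℤ → Ω → ℝ) (k : ℤ) (ω : Ω) : ℝ :=
  ∑' i : ℕ, (∏ l ∈ Finset.range i, constExtend f (((k : ℝ) - (l : ℝ)) / (N : ℝ))) * ε (k - i) ω

/-- The series converges almost surely and satisfies the autoregressive equation. -/
theorem tvAR_recursion {Ω : Type*} [MeasurableSpace Ω] {P : Measure Ω}
    {ε : ℤ → Ω → ℝ} {f : ℝ → ℝ} {ρ : ℝ} (hρ : ρ < 1)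
    (hf : ∀ y ∈ Set.Icc (0 : ℝ) 1, 0 ≤ f y ∧ f y ≤ ρ) (hmeas : ∀ k, Measurable (ε k))
    (hid : ∀ k, IdentDistrib (ε k) (ε 0) P P) (hint : Integrable (ε 0) P) (N : ℕ) :
    ∀ᵐ ω ∂P, ∀ k : ℤ,
      (Summable fun i : ℕ =>
        (∏ l ∈ Finset.range i, constExtend f (((k : ℝ) - (l : ℝ)) / (N : ℝ))) * ε (k - i) ω) ∧
      tvAR N f ε k ω = constExtend f ((k : ℝ) / N) * tvAR N f ε (k - 1) ω + ε k ω := by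
  have hfe : ∀ u, 0 ≤ constExtend f u ∧ constExtend f u ≤ ρ := fun u =>
    hf _ ⟨le_max_left _ _, max_le zero_le_one (min_le_right _ _)⟩
  have hρ0 : 0 ≤ ρ := (hfe 0).1.trans (hfe 0).2
  have hsum : ∀ᵐ ω ∂P, ∀ k : ℤ, Summable fun i : ℕ => ρ ^ i * |ε (k - i) ω| := by
    rw [ae_all_iff]
    intro k
    have h1 : ∫⁻ ω, ∑' i : ℕ, ENNReal.ofReal (ρ ^ i * |ε (k - i) ω|) ∂P ≠ ⊤ := by
      rw [lintegral_tsum]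
      · have h2 : ∀ i : ℕ, ∫⁻ ω, ENNReal.ofReal (ρ ^ i * |ε (k - i) ω|) ∂P =
            ENNReal.ofReal ρ ^ i * ∫⁻ ω, ‖ε 0 ω‖ₑ ∂P := by
          intro i
          have h3 : ∫⁻ ω, ‖ε (k - i) ω‖ₑ ∂P = ∫⁻ ω, ‖ε 0 ω‖ₑ ∂P :=
            ((hid (k - i)).comp measurable_enorm).lintegral_eq
          rw [← h3, ← lintegral_const_mul _ (hmeas _).enorm]
          refine lintegral_congr fun ω => ?_
          rw [ENNReal.ofReal_mul (pow_nonneg hρ0 i), ENNReal.ofReal_pow hρ0,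
            Real.enorm_eq_ofReal_abs]
        simp_rw [h2]
        rw [ENNReal.tsum_mul_right, ENNReal.tsum_geometric]
        refine ENNReal.mul_ne_top ?_ hint.2.ne
        simp [tsub_eq_zero_iff_le, hρ]
      · intro i
        exact (((hmeas _).abs.const_mul _).ennreal_ofReal).aemeasurable
    have h4 := ae_lt_top' (AEMeasurable.tsum fun i : ℕ =>
      ((((hmeas (k - i)).abs.const_mul (ρ ^ i)).ennreal_ofReal).aemeasurable (μ := P))) h1
    filter_upwards [h4] with ω hω
    have h5 := ENNReal.summable_toReal hω.ne
    refine h5.congr fun i => ?_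
    exact ENNReal.toReal_ofReal (mul_nonneg (pow_nonneg hρ0 i) (abs_nonneg _))
  filter_upwards [hsum] with ω hω
  have hs : ∀ k : ℤ, Summable fun i : ℕ =>
      (∏ l ∈ Finset.range i, constExtend f (((k : ℝ) - (l : ℝ)) / (N : ℝ))) * ε (k - i) ω := by
    intro k
    refine Summable.of_norm_bounded (hω k) fun i => ?_
    rw [norm_mul, Real.norm_eq_abs, Real.norm_eq_abs, abs_of_nonneg
      (Finset.prod_nonneg fun l _ => (hfe _).1)]
    refine mul_le_mul_of_nonneg_right ?_ (abs_nonneg _)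
    refine (Finset.prod_le_prod (fun l _ => (hfe _).1) fun l _ => (hfe _).2).trans ?_
    simp
  intro k
  refine ⟨hs k, ?_⟩
  unfold tvAR
  rw [(hs k).tsum_eq_zero_add, ← tsum_mul_left, add_comm]
  congr 1
  · refine tsum_congr fun i => ?_
    rw [Finset.prod_range_succ']
    have e1 : k - ((i + 1 : ℕ) : ℤ) = k - 1 - (i : ℤ) := by push_cast; ring
    have e2 : ∀ l : ℕ, (k : ℝ) - ((l + 1 : ℕ) : ℝ) = ((k - 1 : ℤ) : ℝ) - (l : ℝ) := by
      intro l; push_cast; ring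
    simp only [e1, e2]
    simp only [Nat.cast_zero, sub_zero]
    ring
  · simp

/-- The regression responses `Y_k = X_k / X_{k-1}`. -/
def response {Ω : Type*} (N : ℕ) (f : ℝ → ℝ) (ε : ℤ → Ω → ℝ) (ω : Ω) (k : ℕ) : ℝ :=
  tvAR N f ε k ω / tvAR N f ε ((k : ℤ) - 1) ω

/-- The indices `k ∈ {1, …, N}` with `|k / N - x| ≤ h`, that is `k / N ∈ [x - h, x + h]`. -/
def window (N : ℕ) (x h : ℝ) : Finset ℕ :=
  {k ∈ Finset.Icc 1 N | |(k : ℝ) / (N : ℝ) - x| ≤ h}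

/-- The local sample size `n(h, x)`. -/
def localSize (N : ℕ) (x h : ℝ) : ℕ := (window N x h).card

/-- The polynomial `p(y) = ∑_{i ≤ d} b_i (y - x)^i`. -/
def localPoly {d : ℕ} (x : ℝ) (b : Fin (d + 1) → ℝ) (y : ℝ) : ℝ :=
  ∑ i, b i * (y - x) ^ (i : ℕ)

/-- The constraints `p(k/N) ≤ Y_k` of the linear program. -/
def LPFeasible {d : ℕ} (N : ℕ) (x h : ℝ) (Y : ℕ → ℝ) (b : Fin (d + 1) → ℝ) : Prop :=
  ∀ k ∈ window N x h, localPoly x b ((k : ℝ) / N) ≤ Y k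

/-- `b` solves the linear program: it maximizes `∑ p(k/N)` over the window, under the constraints. -/
def LPSolution {d : ℕ} (N : ℕ) (x h : ℝ) (Y : ℕ → ℝ) (b : Fin (d + 1) → ℝ) : Prop :=
  LPFeasible N x h Y b ∧ ∀ b' : Fin (d + 1) → ℝ, LPFeasible N x h Y b' →
    ∑ k ∈ window N x h, localPoly x b' ((k : ℝ) / N) ≤
      ∑ k ∈ window N x h, localPoly x b ((k : ℝ) / N)

/-- `t` is a value of the quasi maximum likelihood estimator of degree `d` at `x` with bandwidth `h`
for the data `Y`: the constant coefficient of a solution of the linear program. -/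
def IsQuasiMLE (d N : ℕ) (x h : ℝ) (Y : ℕ → ℝ) (t : ℝ) : Prop :=
  ∃ b : Fin (d + 1) → ℝ, LPSolution N x h Y b ∧ t = b 0

/-- The linear program always has a solution, so the estimator exists for all data. -/
theorem exists_isQuasiMLE (d N : ℕ) (x h : ℝ) (Y : ℕ → ℝ) : ∃ t, IsQuasiMLE d N x h Y t := by
  suffices hb : ∃ b : Fin (d + 1) → ℝ, LPSolution N x h Y b by
    obtain ⟨b, hb⟩ := hb
    exact ⟨b 0, b, hb, rfl⟩
  let A : (Fin (d + 1) → ℝ) →ₗ[ℝ] (window N x h → ℝ) :=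
    { toFun := fun b k => localPoly x b (((k : ℕ) : ℝ) / N)
      map_add' := by
        intro b b'; funext k
        simp [localPoly, add_mul, Finset.sum_add_distrib]
      map_smul' := by
        intro r b; funext k
        simp [localPoly, Finset.mul_sum, mul_assoc] }
  have hA : ∀ b k, A b k = localPoly x b (((k : ℕ) : ℝ) / N) := fun _ _ => rfl
  have hsum : ∀ b, ∑ k ∈ window N x h, localPoly x b ((k : ℝ) / N) = ∑ k, A b k := fun b =>
    (Finset.sum_coe_sort (window N x h) fun k => localPoly x b ((k : ℝ) / N)).symm
  have hfeas : ∀ b, LPFeasible N x h Y b ↔ ∀ k : window N x h, A b k ≤ Y k := fun b =>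
    ⟨fun H k => H k k.2, fun H k hk => H ⟨k, hk⟩⟩
  let b₀ : Fin (d + 1) → ℝ := Pi.single 0 (-∑ k : window N x h, |Y k|)
  have hb₀ : ∀ k, A b₀ k = -∑ k : window N x h, |Y k| := by
    intro k
    rw [hA, localPoly, Finset.sum_eq_single 0]
    · simp [b₀]
    · intro i _ hi; simp [b₀, hi]
    · simp
  have hb₀f : ∀ k : window N x h, A b₀ k ≤ Y k := by
    intro k
    rw [hb₀]
    have := Finset.single_le_sum (f := fun k : window N x h => |Y k|)
      (fun i _ => abs_nonneg _) (Finset.mem_univ k)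
    have h2 := neg_abs_le (Y k)
    linarith
  let S : Set (window N x h → ℝ) :=
    (LinearMap.range A : Set (window N x h → ℝ)) ∩ {w | (∀ k, w k ≤ Y k) ∧ ∑ k, A b₀ k ≤ ∑ k, w k}
  have hSne : S.Nonempty := ⟨A b₀, ⟨b₀, rfl⟩, hb₀f, le_rfl⟩
  have hSc : IsCompact S := by
    refine IsCompact.of_isClosed_subset (isCompact_Icc
      (a := fun k : window N x h => ∑ j, A b₀ j - ∑ j ∈ Finset.univ.erase k, Y j)
      (b := fun k : window N x h => Y k)) ?_ ?_
    · refine (Submodule.closed_of_finiteDimensional _).inter ?_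
      simp only [Set.ofPred_and, Set.ofPred_forall]
      exact (isClosed_iInter fun k => isClosed_le (by fun_prop) (by fun_prop)).inter
        (isClosed_le (by fun_prop) (by fun_prop))
    · rintro w ⟨-, hw1, hw2⟩
      refine ⟨fun k => ?_, hw1⟩
      have h1 := Finset.add_sum_erase Finset.univ w (Finset.mem_univ k)
      have h2 : ∑ j ∈ Finset.univ.erase k, w j ≤ ∑ j ∈ Finset.univ.erase k, Y j :=
        Finset.sum_le_sum fun j _ => hw1 j
      simp only
      linarith
  obtain ⟨w, ⟨⟨b, rfl⟩, hw1, hw2⟩, hmax⟩ := hSc.exists_isMaxOn hSne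
    (f := fun w : window N x h → ℝ => ∑ k, w k) (by fun_prop)
  refine ⟨b, (hfeas b).2 hw1, fun b' hb' => ?_⟩
  rw [hsum, hsum]
  by_cases hc : ∑ k, A b₀ k ≤ ∑ k, A b' k
  · exact hmax ⟨⟨b', rfl⟩, (hfeas b').1 hb', hc⟩
  · linarith

end

/-! The noise is one-sided: `Y_k - f(k/N) = ε_k / X_{k-1}` is positive and, since `X_{k-1} ≥
ε_{k-1}`, at most `ε_k / ε_{k-1}`. Let `q` be the fitted polynomial minus the Taylor polynomial of
`f` at `x`, and let `B` be of order `h ^ β`. The Taylor polynomial lowered by `B` is feasible, so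
optimality forces the average of `q` over the window to be at least `-B`. Wherever the noise is at
most `r`, feasibility gives `q ≤ B + r`.

If each of a fixed number `K` of blocks of the window contains such a point, these two facts bound
`q` by a multiple of `B + r` (`exists_abs_localPoly_le_of_blocks`). Polynomials of bounded degree
form a finite-dimensional space, so `q` cannot oscillate between blocks, and a deep dip would spoil
the average. This gives the deterministic bound `exists_abs_quasiMLE_sub_le`.

A block contains about `n / (2K)` disjoint pairs `(ε_{k-1}, ε_k)`. They are independent, and each
has `ε_k ≤ r ε_{k-1}` with probability at least a constant times `r ^ a`. With `r` of order `n ^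
(-1/a) v`, a block fails with probability at most `exp (-v ^ a)`, and a union bound over the `K`
blocks finishes the proof. -/

/-! ### Local polynomial approximation of Hölder functions. -/

/-- Taylor's bound on `[0,1]` when the top derivative has a modulus of continuity of power type
at `x`. -/
theorem exists_coeff_taylor_bound {L α x : ℝ} (hα : 0 < α) (hx : x ∈ Set.Icc (0 : ℝ) 1) (m : ℕ) :
    ∀ g : ℝ → ℝ, ContDiffOn ℝ m g (Set.Icc 0 1) →
      (∀ y ∈ Set.Icc (0 : ℝ) 1, |iteratedDerivWithin m g (Set.Icc 0 1) y -
        iteratedDerivWithin m g (Set.Icc 0 1) x| ≤ L * |y - x| ^ α) →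
      ∃ c : ℕ → ℝ, c 0 = g x ∧ ∀ y ∈ Set.Icc (0 : ℝ) 1,
        |g y - ∑ i ∈ Finset.range (m + 1), c i * (y - x) ^ i| ≤ L * |y - x| ^ ((m : ℝ) + α) := by
  have hu : UniqueDiffOn ℝ (Set.Icc (0 : ℝ) 1) := uniqueDiffOn_Icc zero_lt_one
  induction m with
  | zero =>
    intro g _ hg
    refine ⟨fun _ => g x, rfl, fun y hy => ?_⟩
    simpa using hg y hy
  | succ m ih =>
    intro g hc hg
    have hc' := (contDiffOn_succ_iff_derivWithin (n := (m : WithTop ℕ∞)) hu).1 (by exact_mod_cast hc)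
    obtain ⟨hd, -, hcd⟩ := hc'
    obtain ⟨c, -, hcb⟩ := ih (derivWithin g (Set.Icc 0 1)) hcd (by
      simpa only [iteratedDerivWithin_succ'] using hg)
    -- Integrate the approximation of the derivative term by term, with integration constant `g x`.
    let c' : ℕ → ℝ := fun i => Nat.casesOn i (g x) fun i => c i / (i + 1)
    refine ⟨c', rfl, fun y hy => ?_⟩
    let G : ℝ → ℝ := fun z => g z - ∑ i ∈ Finset.range (m + 1 + 1), c' i * (z - x) ^ i
    have hGx : G x = 0 := by
      simp only [G]
      rw [Finset.sum_range_succ']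
      simp [c']
    have hder : ∀ z ∈ Set.Icc (0 : ℝ) 1, HasDerivWithinAt G
        (derivWithin g (Set.Icc 0 1) z - ∑ i ∈ Finset.range (m + 1), c i * (z - x) ^ i)
        (Set.Icc 0 1) z := by
      intro z hz
      refine (hd z hz).hasDerivWithinAt.sub (HasDerivAt.hasDerivWithinAt ?_)
      have h1 : (fun z : ℝ => ∑ i ∈ Finset.range (m + 1 + 1), c' i * (z - x) ^ i) =
          fun z => ∑ i ∈ Finset.range (m + 1), c i / ((i : ℝ) + 1) * (z - x) ^ (i + 1) + g x := by
        funext z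
        rw [Finset.sum_range_succ']
        simp [c']
      rw [h1]
      refine HasDerivAt.add_const _ (HasDerivAt.fun_sum fun i _ => ?_)
      have h2 := (((hasDerivAt_id z).sub_const x).pow (i + 1)).const_mul (c i / ((i : ℝ) + 1))
      refine h2.congr_deriv ?_
      have : (i : ℝ) + 1 ≠ 0 := by positivity
      simp only [id, Nat.add_sub_cancel, Nat.cast_add, Nat.cast_one, mul_one]
      field_simp
    rcases eq_or_ne y x with rfl | hne
    · change |G y| ≤ _
      rw [hGx]
      have : ((m + 1 : ℕ) : ℝ) + α ≠ 0 := by positivity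
      rw [sub_self, abs_zero, Real.zero_rpow this, mul_zero]
    have hr : 0 < |y - x| := abs_pos.2 (sub_ne_zero.2 hne)
    have hL : 0 ≤ L := by
      have := (abs_nonneg _).trans (hg y hy)
      exact nonneg_of_mul_nonneg_left this (by positivity)
    -- On the part of `[0,1]` no farther from `x` than `y`, the derivative of `G` is at most `L * |y
    -- - x| ^ (m + α)`. The mean value inequality supplies the extra power, and the factorial gain
    -- is dropped.
    have key := Convex.norm_image_sub_le_of_norm_hasDerivWithin_le
      (s := Set.Icc (0 : ℝ) 1 ∩ Metric.closedBall x |y - x|) (C := L * |y - x| ^ ((m : ℝ) + α))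
      (fun z hz => (hder z hz.1).mono Set.inter_subset_left)
      (fun z hz => by
        refine (hcb z hz.1).trans ?_
        have hzx : |z - x| ≤ |y - x| := by simpa [Real.dist_eq] using hz.2
        gcongr)
      ((convex_Icc 0 1).inter (convex_closedBall _ _))
      (Set.mem_inter hx (by simp)) (Set.mem_inter hy (by simp [Real.dist_eq]))
    rw [hGx, sub_zero, Real.norm_eq_abs, Real.norm_eq_abs, mul_assoc,
      ← Real.rpow_add_one hr.ne'] at key
    refine key.trans (le_of_eq ?_)
    push_cast
    ring_nf

/-- A function in a Hölder class is approximated at `x` by a polynomial of degree at least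
`strictFloor β`, with an error of order `|y - x| ^ β`. -/
theorem HolderClass.exists_localPoly {L β x : ℝ} {f : ℝ → ℝ} {d : ℕ} (hf : HolderClass L β f)
    (hβ : 0 < β) (hx : x ∈ Set.Icc (0 : ℝ) 1) (hd : strictFloor β ≤ d) :
    ∃ c : Fin (d + 1) → ℝ, c 0 = f x ∧
      ∀ y ∈ Set.Icc (0 : ℝ) 1, |f y - localPoly x c y| ≤ L * |y - x| ^ β := by
  have hs : (strictFloor β : ℝ) < β := (isGreatest_strictFloor hβ).1
  obtain ⟨c, hc0, hc⟩ := exists_coeff_taylor_bound (sub_pos.2 hs) hx (strictFloor β) f hf.1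
    fun y hy => hf.2 y hy x hx
  refine ⟨fun i => if (i : ℕ) < strictFloor β + 1 then c i else 0, by simp [hc0], fun y hy => ?_⟩
  have h := hc y hy
  rw [add_sub_cancel] at h
  convert h using 3
  unfold localPoly
  rw [Fin.sum_univ_eq_sum_range
    (fun i => (if i < strictFloor β + 1 then c i else 0) * (y - x) ^ i) (d + 1)]
  simp only [ite_mul, zero_mul]
  rw [← Finset.sum_filter]
  congr 1
  ext i
  simp only [Finset.mem_filter, Finset.mem_range]
  omega

/-! ### One-sided control of polynomials on a grid. -/

/-- A polynomial of degree at most `d` attains a fixed fraction of its coefficient norm at one of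
the nodes `j / (d + 1)`. -/
theorem exists_node_le_abs_localPoly (d : ℕ) :
    ∃ κ : ℝ, 0 < κ ∧ κ ≤ 1 ∧ ∀ b : Fin (d + 1) → ℝ, ∃ j : Fin (d + 1),
      κ * ‖b‖ ≤ |localPoly 0 b ((j : ℝ) / (d + 1))| := by
  let v : Fin (d + 1) → ℝ := fun j => (j : ℝ) / (d + 1)
  have hv : Function.Injective v := by
    intro i j hij
    have h1 : (d : ℝ) + 1 ≠ 0 := by positivity
    have h2 : ((i : ℕ) : ℝ) = ((j : ℕ) : ℝ) := by simpa [v, div_left_inj' h1] using hij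
    exact Fin.ext (by exact_mod_cast h2)
  let A := (Matrix.vandermonde v).mulVecLin
  have hA : ∀ b j, A b j = localPoly 0 b (v j) := by
    intro b j
    simp [A, localPoly, Matrix.mulVec, dotProduct, Matrix.vandermonde_apply, mul_comm]
  -- Evaluation at `d + 1` distinct nodes is a Vandermonde map, hence injective; in finite dimension
  -- it is then bounded below.
  have hker : LinearMap.ker A = ⊥ := by
    refine LinearMap.ker_eq_bot.2 (Matrix.mulVec_injective_iff_isUnit.2 ?_)
    rw [Matrix.isUnit_iff_isUnit_det]
    exact (Matrix.det_vandermonde_ne_zero_iff.2 hv).isUnit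
  obtain ⟨K, hK, hlip⟩ := A.exists_antilipschitzWith hker
  refine ⟨min 1 (K : ℝ)⁻¹, by positivity, min_le_left _ _, fun b => ?_⟩
  obtain ⟨j, hj⟩ := Finite.exists_max fun j => |A b j|
  refine ⟨j, ?_⟩
  have h1 : ‖b‖ ≤ K * ‖A b‖ := by
    simpa using hlip.le_mul_dist b 0
  have h2 : ‖A b‖ ≤ |A b j| := (pi_norm_le_iff_of_nonempty _).2 hj
  have hK' : (0 : ℝ) < K := hK
  change _ ≤ |localPoly 0 b (v j)|
  rw [← hA]
  calc min 1 (K : ℝ)⁻¹ * ‖b‖ ≤ (K : ℝ)⁻¹ * (K * ‖A b‖) := by gcongr; exact min_le_right _ _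
    _ = ‖A b‖ := by field_simp
    _ ≤ _ := h2

theorem abs_localPoly_le {d : ℕ} (b : Fin (d + 1) → ℝ) {u : ℝ} (hu : |u| ≤ 1) :
    |localPoly 0 b u| ≤ (d + 1) * ‖b‖ := by
  unfold localPoly
  refine (Finset.abs_sum_le_sum_abs _ _).trans ?_
  calc ∑ i, |b i * (u - 0) ^ (i : ℕ)| ≤ ∑ i : Fin (d + 1), ‖b‖ := by
        refine Finset.sum_le_sum fun i _ => ?_
        rw [abs_mul, abs_pow, sub_zero]
        exact (mul_le_of_le_one_right (abs_nonneg _) (pow_le_one₀ (abs_nonneg _) hu)).trans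
          (norm_le_pi_norm b i)
    _ = _ := by simp

theorem abs_localPoly_sub_le {d : ℕ} (b : Fin (d + 1) → ℝ) {u w : ℝ} (hu : |u| ≤ 1)
    (hw : |w| ≤ 1) :
    |localPoly 0 b u - localPoly 0 b w| ≤ (d + 1) ^ 2 * ‖b‖ * |u - w| := by
  unfold localPoly
  rw [← Finset.sum_sub_distrib]
  refine (Finset.abs_sum_le_sum_abs _ _).trans ?_
  calc ∑ i, |b i * (u - 0) ^ (i : ℕ) - b i * (w - 0) ^ (i : ℕ)|
      ≤ ∑ i : Fin (d + 1), ‖b‖ * (|u - w| * (d + 1)) := by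
        refine Finset.sum_le_sum fun i _ => ?_
        rw [← mul_sub, abs_mul, sub_zero, sub_zero]
        refine mul_le_mul (norm_le_pi_norm b i) ?_ (abs_nonneg _) (norm_nonneg _)
        refine (abs_pow_sub_pow_le u w i).trans ?_
        have h1 : max |u| |w| ^ ((i : ℕ) - 1) ≤ 1 :=
          pow_le_one₀ (le_max_of_le_left (abs_nonneg _)) (max_le hu hw)
        have h2 : ((i : ℕ) : ℝ) ≤ d + 1 := by exact_mod_cast i.2.le
        calc |u - w| * (i : ℕ) * max |u| |w| ^ ((i : ℕ) - 1) ≤ |u - w| * (d + 1) * 1 := by gcongr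
          _ = _ := by ring
    _ = _ := by simp; ring

/-- Every point of `[0,1)` is close to all the points of one of `K` consecutive blocks of grid
points. -/
theorem exists_block_near {n K : ℕ} (hK : 0 < K) (hn : K * K ≤ n) {t : ℝ} (ht0 : 0 ≤ t)
    (ht1 : t < 1) :
    ∃ j < K, ∀ i : ℕ, j * (n / K) ≤ i → i < (j + 1) * (n / K) →
      |t - (i : ℝ) / n| ≤ 3 / K := by
  have hn0 : 0 < n := lt_of_lt_of_le (Nat.mul_pos hK hK) hn
  set m := n / K with hm
  -- The fewer than `K ≤ m` grid points left over after the `K` blocks fit within one block length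
  -- and are attached to the last block. Hence the range `(j + 2) * m` below, and the constant 3.
  have hKm : K ≤ m := (Nat.le_div_iff_mul_le hK).2 hn
  have hm1 : m * K ≤ n := Nat.div_mul_le_self n K
  have hm2 : n < m * K + K := by
    have := Nat.lt_div_mul_add (a := n) hK
    simpa [hm] using this
  have hnR : (0 : ℝ) < n := by exact_mod_cast hn0
  have hKR : (0 : ℝ) < K := by exact_mod_cast hK
  set i₀ := ⌊t * n⌋₊ with hi₀
  have h1 : (i₀ : ℝ) ≤ t * n := Nat.floor_le (by positivity)
  have h2 : t * n < i₀ + 1 := Nat.lt_floor_add_one _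
  have h3 : i₀ < n := by
    have : (i₀ : ℝ) < n := h1.trans_lt (by nlinarith)
    exact_mod_cast this
  have hj : ∃ j < K, j * m ≤ i₀ ∧ i₀ < (j + 2) * m := by
    rcases lt_or_ge (i₀ / m) K with h | h
    · refine ⟨i₀ / m, h, Nat.div_mul_le_self _ _, ?_⟩
      have := Nat.lt_div_mul_add (a := i₀) (b := m) (by omega)
      nlinarith
    · refine ⟨K - 1, by omega, ?_, ?_⟩
      · exact (Nat.mul_le_mul_right m (by omega)).trans (Nat.div_mul_le_self i₀ m)
      · obtain ⟨k, rfl⟩ : ∃ k, K = k + 1 := ⟨K - 1, by omega⟩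
        simp only [Nat.add_sub_cancel]
        nlinarith
  obtain ⟨j, hjK, hj1, hj2⟩ := hj
  refine ⟨j, hjK, fun i hi1 hi2 => ?_⟩
  have e1 : (j : ℝ) * m ≤ i₀ := by exact_mod_cast hj1
  have e2 : (i₀ : ℝ) < (j + 2) * m := by exact_mod_cast hj2
  have e3 : (j : ℝ) * m ≤ i := by exact_mod_cast hi1
  have e4 : (i : ℝ) < (j + 1) * m := by exact_mod_cast hi2
  have e5 : (m : ℝ) * K ≤ n := by exact_mod_cast hm1
  have e6 : (1 : ℝ) ≤ m := by exact_mod_cast (by omega : 1 ≤ m)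
  have e7 : (m : ℝ) ≤ n / K := (le_div_iff₀ hKR).2 e5
  have h4 : |t * n - i| ≤ 3 * (n / K) := by
    rw [abs_le]
    constructor <;> nlinarith
  have h5 : t - (i : ℝ) / n = (t * n - i) / n := by field_simp
  rw [h5, abs_div, abs_of_pos hnR, div_le_iff₀ hnR]
  calc _ ≤ _ := h4
    _ = _ := by ring

set_option maxHeartbeats 800000 in
/-- A polynomial whose average over a fine grid of `[0,1)` is at least `-B`, and which is at most
`B` somewhere in each of finitely many blocks of grid points, is bounded by a multiple of `B`. -/
theorem exists_abs_localPoly_le_of_blocks (d : ℕ) :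
    ∃ (K n₀ : ℕ) (C : ℝ), 0 < K ∧ 0 < C ∧ ∀ n : ℕ, n₀ ≤ n → ∀ (b : Fin (d + 1) → ℝ) (B : ℝ),
      0 ≤ B → (∀ j < K, ∃ i : ℕ, j * (n / K) ≤ i ∧ i < (j + 1) * (n / K) ∧
        localPoly 0 b ((i : ℝ) / n) ≤ B) →
      -(n * B) ≤ ∑ i ∈ Finset.range n, localPoly 0 b ((i : ℝ) / n) →
      ∀ u : ℝ, |u| ≤ 1 → |localPoly 0 b u| ≤ C * B := by
  obtain ⟨κ, hκ, hκ1, hnode⟩ := exists_node_le_abs_localPoly d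
  set D : ℝ := ((d : ℝ) + 1) ^ 2 with hD
  have hd1 : (1 : ℝ) ≤ (d : ℝ) + 1 := by linarith [Nat.cast_nonneg (α := ℝ) d]
  have hDd : (d : ℝ) + 1 ≤ D := by rw [hD]; nlinarith
  have hD0 : 0 < D := by positivity
  -- On an interval of length `l` the polynomial changes by at most `κ / 2 * ‖b‖`, half of its
  -- guaranteed size at a node.
  set l : ℝ := κ / (2 * D) with hl
  have hl0 : 0 < l := by positivity
  have hl1 : l ≤ 1 / (d + 1) := by
    rw [hl, div_le_div_iff₀ (by positivity) (by positivity)]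
    nlinarith
  have hlκ : D * l = κ / 2 := by rw [hl]; field_simp
  have hl2 : l ≤ 1 := hl1.trans ((div_le_one (by positivity)).2 hd1)
  -- The blocks are short enough that passing from a good point to any nearby `t` costs at most `l *
  -- κ / 8 * ‖b‖`.
  set K : ℕ := ⌈24 * D / (l * κ)⌉₊ with hKdef
  have hK : 0 < K := Nat.ceil_pos.2 (by positivity)
  have hKR : (0 : ℝ) < K := by exact_mod_cast hK
  have hK1 : D * (3 / K) ≤ l * κ / 8 := by
    have h1 : 24 * D / (l * κ) ≤ K := Nat.le_ceil _
    rw [div_le_iff₀ (by positivity)] at h1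
    rw [mul_div_assoc', div_le_iff₀ hKR]
    linarith
  refine ⟨K, max (K * K) ⌈2 / l⌉₊, ((d : ℝ) + 1) * (16 / (l * κ)), hK, by positivity, ?_⟩
  intro n hn b B hB hblock hsum u hu
  have hnK : K * K ≤ n := (le_max_left _ _).trans hn
  have hn0 : 0 < n := lt_of_lt_of_le (Nat.mul_pos hK hK) hnK
  have hnR : (0 : ℝ) < n := by exact_mod_cast hn0
  have hnl : 2 ≤ l * n := by
    have h1 : (2 / l : ℝ) ≤ n := (Nat.le_ceil _).trans (by exact_mod_cast (le_max_right _ _).trans hn)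
    rw [div_le_iff₀ hl0] at h1
    linarith
  have hlip : ∀ {s t : ℝ}, |s| ≤ 1 → |t| ≤ 1 →
      |localPoly 0 b s - localPoly 0 b t| ≤ D * ‖b‖ * |s - t| := fun hs ht =>
    abs_localPoly_sub_le b hs ht
  have hup : ∀ t : ℝ, 0 ≤ t → t < 1 → localPoly 0 b t ≤ B + l * κ / 8 * ‖b‖ := by
    intro t ht0 ht1
    obtain ⟨j, hj, hnear⟩ := exists_block_near hK hnK ht0 ht1
    obtain ⟨i, hi1, hi2, hi⟩ := hblock j hj
    have hin : i < n := by
      refine hi2.trans_le ((Nat.mul_le_mul_right _ hj).trans ?_)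
      exact Nat.mul_div_le n K
    have hi01 : |(i : ℝ) / n| ≤ 1 := by
      rw [abs_of_nonneg (by positivity), div_le_one hnR]
      exact_mod_cast hin.le
    have h1 := (abs_le.1 (hlip (abs_le.2 ⟨by linarith, ht1.le⟩ : |t| ≤ 1) hi01)).2
    have h2 : D * ‖b‖ * |t - (i : ℝ) / n| ≤ D * ‖b‖ * (3 / K) := by
      gcongr
      exact hnear i hi1 hi2
    have h3 : D * (3 / K) * ‖b‖ ≤ l * κ / 8 * ‖b‖ := by gcongr
    linarith
  obtain ⟨j, hj⟩ := hnode b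
  set t₀ : ℝ := (j : ℝ) / (d + 1) with ht₀
  have hjd : ((j : ℕ) : ℝ) ≤ d := by exact_mod_cast Nat.lt_succ_iff.1 j.2
  have ht0 : 0 ≤ t₀ := by positivity
  have ht1 : t₀ + l ≤ 1 := by
    have : t₀ + 1 / (d + 1) ≤ 1 := by
      rw [ht₀, ← add_div, div_le_one (by positivity)]
      linarith
    linarith
  have hb : ‖b‖ ≤ 16 / (l * κ) * B := by
    rw [div_mul_eq_mul_div, le_div_iff₀ (by positivity)]
    have hb0 := norm_nonneg b
    have hlκ1 : l * κ * ‖b‖ ≤ κ * ‖b‖ := by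
      have : l * κ ≤ κ := by nlinarith
      gcongr
    have hup0 := hup t₀ ht0 (by linarith)
    -- A large positive node value contradicts `hup0` unless `‖b‖` is of order `B`. A large negative
    -- one persists on about `l * n` grid points; their contribution of at most `-(l * n / 2) * (κ /
    -- 2 * ‖b‖)` outweighs the slack `n * l * κ / 8 * ‖b‖` of the upper bound elsewhere.
    rcases le_abs.1 hj with hpos | hneg
    · nlinarith
    · set i₀ : ℕ := ⌈t₀ * n⌉₊ with hi₀
      set M : ℕ := ⌊l * n⌋₊ with hM
      have hM1 : (M : ℝ) ≤ l * n := Nat.floor_le (by positivity)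
      have hM2 : l * n < M + 1 := Nat.lt_floor_add_one _
      have hi1 : t₀ * n ≤ i₀ := Nat.le_ceil _
      have hi2 : (i₀ : ℝ) < t₀ * n + 1 := Nat.ceil_lt_add_one (by positivity)
      have hiM : i₀ + M ≤ n := by
        have : ((i₀ + M : ℕ) : ℝ) < n + 1 := by
          push_cast
          nlinarith
        exact Nat.lt_succ_iff.1 (by exact_mod_cast this)
      have hsub : Finset.Ico i₀ (i₀ + M) ⊆ Finset.range n := by
        intro i hi
        simp only [Finset.mem_Ico, Finset.mem_range] at hi ⊢
        omega
      have hgrid : ∀ i ∈ Finset.range n, localPoly 0 b ((i : ℝ) / n) ≤ B + l * κ / 8 * ‖b‖ := by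
        intro i hi
        refine hup _ (by positivity) ((div_lt_one hnR).2 ?_)
        exact_mod_cast Finset.mem_range.1 hi
      have hlow : ∀ i ∈ Finset.Ico i₀ (i₀ + M), localPoly 0 b ((i : ℝ) / n) ≤ -(κ / 2 * ‖b‖) := by
        intro i hi
        obtain ⟨hi3, hi4⟩ := Finset.mem_Ico.1 hi
        have hi3' : (i₀ : ℝ) ≤ i := by exact_mod_cast hi3
        have hi4' : (i : ℝ) + 1 ≤ i₀ + M := by exact_mod_cast hi4
        have g1 : t₀ ≤ (i : ℝ) / n := (le_div_iff₀ hnR).2 (by linarith)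
        have g2 : (i : ℝ) / n ≤ t₀ + l := (div_le_iff₀ hnR).2 (by nlinarith)
        have g3 := (abs_le.1 (hlip (s := (i : ℝ) / n) (t := t₀)
          (abs_le.2 ⟨by linarith, by linarith⟩) (abs_le.2 ⟨by linarith, by linarith⟩))).2
        have g4 : D * ‖b‖ * |(i : ℝ) / n - t₀| ≤ D * ‖b‖ * l := by
          gcongr
          rw [abs_of_nonneg (by linarith)]
          linarith
        have g5 : D * ‖b‖ * l = κ / 2 * ‖b‖ := by rw [← hlκ]; ring
        linarith
      have hs1 : ∑ i ∈ Finset.range n, localPoly 0 b ((i : ℝ) / n) ≤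
          n * (B + l * κ / 8 * ‖b‖) - M * (κ / 2 * ‖b‖) := by
        rw [← Finset.sum_sdiff hsub]
        have s1 : ∑ i ∈ Finset.range n \ Finset.Ico i₀ (i₀ + M), localPoly 0 b ((i : ℝ) / n) ≤
            n * (B + l * κ / 8 * ‖b‖) := by
          refine (Finset.sum_le_card_nsmul _ _ _ fun i hi =>
            hgrid i (Finset.mem_sdiff.1 hi).1).trans ?_
          rw [nsmul_eq_mul]
          refine mul_le_mul_of_nonneg_right ?_ (by positivity)
          exact_mod_cast (Finset.card_le_card Finset.sdiff_subset).trans (Finset.card_range n).le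
        have s2 := Finset.sum_le_card_nsmul _ _ _ hlow
        rw [nsmul_eq_mul, Nat.card_Ico, Nat.add_sub_cancel_left] at s2
        linarith
      have hM3 : l * n / 2 ≤ M := by linarith
      have hM4 : l * n / 2 * (κ / 2 * ‖b‖) ≤ M * (κ / 2 * ‖b‖) := by gcongr
      have h6 : 0 ≤ n * (16 * B - l * κ * ‖b‖) := by linarith
      have h7 := nonneg_of_mul_nonneg_right h6 hnR
      linarith
  calc |localPoly 0 b u| ≤ ((d : ℝ) + 1) * ‖b‖ := abs_localPoly_le b hu
    _ ≤ ((d : ℝ) + 1) * (16 / (l * κ) * B) := by gcongr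
    _ = _ := by ring

/-! ### Small ratios of consecutive innovations. -/

/-- Disjoint consecutive pairs of an independent sequence are independent. -/
theorem measureReal_forall_pairs_lt_le {Ω : Type*} [MeasurableSpace Ω] {P : Measure Ω}
    [IsProbabilityMeasure P] {e : ℕ → Ω → ℝ} (hind : iIndepFun e P) (hm : ∀ k, Measurable (e k))
    {r q : ℝ} (hq : ∀ l : ℕ, P.real {ω | r * e (2 * l) ω < e (2 * l + 1) ω} ≤ q) (M : ℕ) :
    P.real {ω | ∀ l < M, r * e (2 * l) ω < e (2 * l + 1) ω} ≤ q ^ M := by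
  induction M with
  | zero => simp
  | succ M ih =>
    have hq0 : 0 ≤ q := measureReal_nonneg.trans (hq 0)
    let S : Set ℕ := {k | k < 2 * M}
    let T : Set ℕ := {k | 2 * M ≤ k}
    have hST : Disjoint S T := Set.disjoint_left.2 fun k hk hk' =>
      absurd (show k < 2 * M from hk) (not_lt.2 hk')
    have hI := indep_iSup_of_disjoint (fun k => (hm k).comap_le) hind.iIndep hST
    have hmeas : ∀ (U : Set ℕ) (k : ℕ), k ∈ U →
        Measurable[⨆ i ∈ U, MeasurableSpace.comap (e i) inferInstance] (e k) := fun U k hk =>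
      (comap_measurable (e k)).mono
        (le_iSup₂ (f := fun i (_ : i ∈ U) => MeasurableSpace.comap (e i) inferInstance) k hk) le_rfl
    have hlt : ∀ (m : MeasurableSpace Ω) (u v : Ω → ℝ), Measurable[m] u → Measurable[m] v →
        MeasurableSet[m] {ω | u ω < v ω} := fun m u v hu hv => measurableSet_lt hu hv
    have h1 : MeasurableSet[⨆ i ∈ S, MeasurableSpace.comap (e i) inferInstance]
        {ω | ∀ l < M, r * e (2 * l) ω < e (2 * l + 1) ω} := by
      rw [show {ω | ∀ l < M, r * e (2 * l) ω < e (2 * l + 1) ω} =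
        ⋂ l, ⋂ (_ : l < M), {ω | r * e (2 * l) ω < e (2 * l + 1) ω} by ext; simp]
      refine MeasurableSet.iInter fun l => MeasurableSet.iInter fun hl => ?_
      exact hlt _ _ _
        ((hmeas S _ (show 2 * l < 2 * M by omega)).const_mul r)
        (hmeas S _ (show 2 * l + 1 < 2 * M by omega))
    have h2 : MeasurableSet[⨆ i ∈ T, MeasurableSpace.comap (e i) inferInstance]
        {ω | r * e (2 * M) ω < e (2 * M + 1) ω} :=
      hlt _ _ _
        ((hmeas T _ (show 2 * M ≤ 2 * M by omega)).const_mul r)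
        (hmeas T _ (show 2 * M ≤ 2 * M + 1 by omega))
    have h3 := (Indep_iff _ _ P).1 hI _ _ h1 h2
    have h4 : {ω | ∀ l < M + 1, r * e (2 * l) ω < e (2 * l + 1) ω} =
        {ω | ∀ l < M, r * e (2 * l) ω < e (2 * l + 1) ω} ∩
          {ω | r * e (2 * M) ω < e (2 * M + 1) ω} := by
      ext ω
      simp only [Set.mem_inter_iff, Set.mem_ofPred_eq, Nat.forall_lt_succ_right]
    rw [h4, measureReal_def, h3, ENNReal.toReal_mul, pow_succ]
    exact mul_le_mul ih (hq M) measureReal_nonneg (pow_nonneg hq0 M)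

section Innovations

variable {Ω : Type*} [MeasurableSpace Ω] {P : Measure Ω} {ε : ℤ → Ω → ℝ} {a : ℝ}

theorem InnovationAssumption.measureReal_le_eq [IsProbabilityMeasure P]
    (hε : InnovationAssumption P ε a) (k : ℤ) (y : ℝ) :
    P.real {ω | ε k ω ≤ y} = cdf (P.map (ε 0)) y := by
  have := Measure.isProbabilityMeasure_map (μ := P) (hε.measurable 0).aemeasurable
  rw [cdf_eq_real, map_measureReal_apply (hε.measurable 0) measurableSet_Iic, measureReal_def,
    measureReal_def]
  congr 1
  exact (hε.ident k).measure_mem_eq measurableSet_Iic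

theorem InnovationAssumption.tendsto_cdf (hε : InnovationAssumption P ε a) :
    Tendsto (fun y => cdf (P.map (ε 0)) y) (𝓝[>] 0) (𝓝 0) := by
  obtain ⟨c, cg, δ, hc, hcg, hδ, h⟩ := hε.decay
  have ha := hε.shape_pos
  have hpow : ∀ p : ℝ, 0 < p → Tendsto (fun y : ℝ => y ^ p) (𝓝[>] 0) (𝓝 0) := by
    intro p hp
    have h1 := (Real.continuousAt_rpow_const 0 p (Or.inr hp.le)).tendsto
    rw [Real.zero_rpow hp.ne'] at h1
    exact h1.mono_left nhdsWithin_le_nhds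
  have hlim : Tendsto (fun y : ℝ => c * y ^ a + cg * y ^ (a + δ)) (𝓝[>] 0) (𝓝 0) := by
    simpa using ((hpow a ha).const_mul c).add ((hpow (a + δ) (by positivity)).const_mul cg)
  refine tendsto_of_tendsto_of_tendsto_of_le_of_le' tendsto_const_nhds hlim
    (Eventually.of_forall fun y => cdf_nonneg _ y) ?_
  filter_upwards [h] with y hy
  linarith [(abs_le.1 hy).2]

theorem InnovationAssumption.ae_pos [IsProbabilityMeasure P] (hε : InnovationAssumption P ε a) :
    ∀ᵐ ω ∂P, ∀ k, 0 < ε k ω := by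
  rw [ae_all_iff]
  intro k
  have h0 : cdf (P.map (ε 0)) 0 ≤ 0 :=
    ge_of_tendsto hε.tendsto_cdf (eventually_mem_nhdsWithin.mono fun y hy =>
      monotone_cdf _ (le_of_lt hy))
  have h1 : P.real {ω | ε k ω ≤ 0} = 0 := by
    rw [hε.measureReal_le_eq k 0]
    exact le_antisymm h0 (cdf_nonneg _ _)
  rw [measureReal_eq_zero_iff] at h1
  rw [ae_iff]
  simpa using h1

/-- Near zero the remainder, of relative size `cg * y ^ δ`, consumes at most half of the leading
term. -/
theorem InnovationAssumption.eventually_le_cdf (hε : InnovationAssumption P ε a) :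
    ∃ c : ℝ, 0 < c ∧ ∀ᶠ y in 𝓝[>] (0 : ℝ), c * y ^ a ≤ cdf (P.map (ε 0)) y := by
  obtain ⟨c, cg, δ, hc, hcg, hδ, h⟩ := hε.decay
  refine ⟨c / 2, by positivity, ?_⟩
  have hlim : Tendsto (fun y : ℝ => cg * y ^ δ) (𝓝[>] 0) (𝓝 0) := by
    have h1 := (Real.continuousAt_rpow_const 0 δ (Or.inr hδ.le)).tendsto
    rw [Real.zero_rpow hδ.ne'] at h1
    simpa using (h1.mono_left nhdsWithin_le_nhds).const_mul cg
  filter_upwards [h, hlim.eventually (eventually_le_nhds (show (0 : ℝ) < c / 2 by positivity)),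
    eventually_mem_nhdsWithin] with y hy hy2 hy0
  have hy0' : (0 : ℝ) < y := hy0
  rw [Real.rpow_add hy0'] at hy
  have h2 := (abs_le.1 hy).1
  have h3 : cg * y ^ δ * y ^ a ≤ c / 2 * y ^ a := by gcongr
  linarith

/-- The probability that none of the ratios of `M` disjoint consecutive pairs of innovations is at
most `r`. -/
theorem InnovationAssumption.exists_measureReal_forall_pairs_le [IsProbabilityMeasure P]
    (hε : InnovationAssumption P ε a) :
    ∃ c r₀ : ℝ, 0 < c ∧ 0 < r₀ ∧ ∀ (s : ℤ) (M : ℕ) (r : ℝ), 0 ≤ r → r ≤ r₀ →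
      P.real {ω | ∀ l < M, r * ε (s + (2 * l : ℕ)) ω < ε (s + (2 * l + 1 : ℕ)) ω} ≤
        Real.exp (-(c * r ^ a * M)) := by
  have ha := hε.shape_pos
  obtain ⟨c, hc, hlow⟩ := hε.eventually_le_cdf
  obtain ⟨y₀, hy₀, hlow⟩ := mem_nhdsGT_iff_exists_Ioc_subset.1 hlow
  -- With probability at least 1/2 an innovation exceeds `η`. Then `ε_j ≤ r * η` suffices for `ε_j ≤
  -- r * ε_i`, so independence reduces the ratio to the lower tail of one innovation.
  obtain ⟨η, hη, hη0⟩ := ((hε.tendsto_cdf.eventually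
    (eventually_le_nhds (show (0 : ℝ) < 1 / 2 by norm_num))).and eventually_mem_nhdsWithin).exists
  have hη0 : (0 : ℝ) < η := hη0
  have hy₀ : (0 : ℝ) < y₀ := hy₀
  refine ⟨c * η ^ a / 2, y₀ / η, by positivity, by positivity, fun s M r hr hr1 => ?_⟩
  rcases hr.eq_or_lt with rfl | hr0
  · simp [Real.zero_rpow ha.ne']
  have hp : ∀ i j : ℤ, i ≠ j → P.real {ω | r * ε i ω < ε j ω} ≤
      Real.exp (-(c * η ^ a / 2 * r ^ a)) := by
    intro i j hij
    have h1 : c * (r * η) ^ a ≤ P.real {ω | ε j ω ≤ r * η} := by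
      rw [hε.measureReal_le_eq j]
      exact hlow ⟨by positivity, (le_div_iff₀ hη0).1 hr1⟩
    have h2 : 1 / 2 ≤ P.real {ω | ε i ω ≤ η}ᶜ := by
      rw [probReal_compl_eq_one_sub (measurableSet_le (hε.measurable i) measurable_const),
        hε.measureReal_le_eq i]
      linarith
    have h3 : P.real ({ω | ε i ω ≤ η}ᶜ ∩ {ω | ε j ω ≤ r * η}) =
        P.real {ω | ε i ω ≤ η}ᶜ * P.real {ω | ε j ω ≤ r * η} := by
      rw [measureReal_def, measureReal_def, measureReal_def, ← ENNReal.toReal_mul]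
      congr 1
      exact (hε.indep.indepFun hij).measure_inter_preimage_eq_mul _ _ measurableSet_Iic.compl
        measurableSet_Iic
    have h4 : P.real {ω | r * ε i ω < ε j ω} ≤
        P.real ({ω | ε i ω ≤ η}ᶜ ∩ {ω | ε j ω ≤ r * η})ᶜ := by
      refine measureReal_mono ?_
      rintro ω hω ⟨h5, h6⟩
      simp only [Set.mem_compl_iff, Set.mem_ofPred_eq, not_le] at hω h5 h6
      nlinarith
    rw [probReal_compl_eq_one_sub ((measurableSet_le (hε.measurable i)
      measurable_const).compl.inter (measurableSet_le (hε.measurable j) measurable_const)), h3] at h4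
    have h7 : 1 / 2 * (c * (r * η) ^ a) ≤
        P.real {ω | ε i ω ≤ η}ᶜ * P.real {ω | ε j ω ≤ r * η} := by gcongr
    rw [Real.mul_rpow hr hη0.le] at h7
    have h8 := Real.add_one_le_exp (-(c * η ^ a / 2 * r ^ a))
    linarith
  have hind : iIndepFun (fun k : ℕ => ε (s + (k : ℤ))) P :=
    hε.indep.precomp (g := fun k : ℕ => s + (k : ℤ)) fun i j hij => by simpa using hij
  have h := measureReal_forall_pairs_lt_le hind (fun k => hε.measurable _)
    (r := r) (fun l => hp _ _ (by push_cast; omega)) M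
  refine h.trans (le_of_eq ?_)
  rw [← Real.exp_nat_mul]
  congr 1
  ring

/-- Almost surely, the responses lie above the regression function, by at most the ratio of two
consecutive innovations. -/
theorem InnovationAssumption.ae_response_bounds [IsProbabilityMeasure P]
    (hε : InnovationAssumption P ε a) {ρ : ℝ} (hρ : ρ < 1) {f : ℝ → ℝ} (hf : ∀ y ∈ Set.Icc (0 : ℝ) 1, 0 ≤ f y ∧ f y ≤ ρ) (N : ℕ) :
    ∀ᵐ ω ∂P, ∀ k : ℕ, k ≤ N → f ((k : ℝ) / N) ≤ response N f ε ω k ∧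
      ∀ r : ℝ, 0 ≤ r → ε k ω ≤ r * ε ((k : ℤ) - 1) ω →
        response N f ε ω k ≤ f ((k : ℝ) / N) + r := by
  have hint : Integrable (ε 0) P := by
    obtain ⟨δ', -, h⟩ := hε.moments
    simpa using h 1 zero_le_one (le_max_left _ _)
  have hfe : ∀ u, 0 ≤ constExtend f u := fun u =>
    (hf _ ⟨le_max_left _ _, max_le zero_le_one (min_le_right _ _)⟩).1
  filter_upwards [hε.ae_pos, tvAR_recursion hρ hf hε.measurable hε.ident hint N] with ω hpos hrec
  intro k hk
  have hX0 : ∀ j, 0 ≤ tvAR N f ε j ω := fun j =>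
    tsum_nonneg fun i => mul_nonneg (Finset.prod_nonneg fun l _ => hfe _) (hpos _).le
  -- Replacing the whole past by its latest innovation leaves a ratio that depends on two
  -- innovations only, which makes disjoint pairs independent.
  have hX1 : ε ((k : ℤ) - 1) ω ≤ tvAR N f ε ((k : ℤ) - 1) ω := by
    rw [(hrec ((k : ℤ) - 1)).2]
    linarith [mul_nonneg (hfe ((((k : ℤ) - 1 : ℤ) : ℝ) / N)) (hX0 ((k : ℤ) - 1 - 1))]
  have hXp : 0 < tvAR N f ε ((k : ℤ) - 1) ω := (hpos _).trans_le hX1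
  have hkN : (k : ℝ) / N ≤ 1 := div_le_one_of_le₀ (by exact_mod_cast hk) (Nat.cast_nonneg _)
  have hfk : constExtend f (((k : ℤ) : ℝ) / N) = f ((k : ℝ) / N) := by
    rw [constExtend, Int.cast_natCast, min_eq_left hkN, max_eq_right (by positivity)]
  have hresp : response N f ε ω k =
      f ((k : ℝ) / N) + ε k ω / tvAR N f ε ((k : ℤ) - 1) ω := by
    rw [response, (hrec k).2, hfk]
    field_simp
  rw [hresp]
  refine ⟨?_, fun r hr hle => ?_⟩
  · linarith [div_pos (hpos k) hXp]
  · have h1 : ε k ω / tvAR N f ε ((k : ℤ) - 1) ω ≤ r := by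
      rw [div_le_iff₀ hXp]
      exact hle.trans (mul_le_mul_of_nonneg_left hX1 hr)
    linarith

end Innovations

/-! ### The window as a rescaled grid, and the deterministic error bound. -/

theorem mem_window {N : ℕ} {x h : ℝ} (hN : 1 ≤ N) {k : ℕ} :
    k ∈ window N x h ↔ 1 ≤ k ∧ k ≤ N ∧ N * (x - h) ≤ k ∧ (k : ℝ) ≤ N * (x + h) := by
  have hNR : (0 : ℝ) < N := by exact_mod_cast hN
  rw [window, Finset.mem_filter, Finset.mem_Icc, abs_le, and_assoc]
  refine and_congr_right fun _ => and_congr_right fun _ => and_congr ?_ ?_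
  · rw [le_sub_iff_add_le, le_div_iff₀ hNR]
    ring_nf
  · rw [sub_le_iff_le_add, div_le_iff₀ hNR]
    ring_nf

/-- A nonempty window is an interval of consecutive integers, whose neighbourhood contains `N x`. -/
theorem exists_window_eq_Ico {N : ℕ} {x h : ℝ} (hN : 1 ≤ N) (hx : x ∈ Set.Icc (0 : ℝ) 1)
    (hh : 0 < h) (hn : 0 < localSize N x h) :
    ∃ s : ℕ, 1 ≤ s ∧ window N x h = Finset.Ico s (s + localSize N x h) ∧
      (s : ℝ) - 1 ≤ N * x ∧ N * x ≤ s + localSize N x h := by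
  have hNR : (0 : ℝ) < N := by exact_mod_cast hN
  have hNx0 : 0 ≤ N * x := mul_nonneg hNR.le hx.1
  have hNx1 : N * x ≤ N := mul_le_of_le_one_right hNR.le hx.2
  have hNh : 0 < N * h := mul_pos hNR hh
  have hW : (window N x h).Nonempty := Finset.card_pos.1 hn
  set p := (window N x h).min' hW with hp
  set q := (window N x h).max' hW with hq
  have hpm : p ∈ window N x h := Finset.min'_mem _ _
  have hqm : q ∈ window N x h := Finset.max'_mem _ _
  have hpq : p ≤ q := Finset.min'_le _ _ hqm
  have hpm' := (mem_window hN).1 hpm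
  have hqm' := (mem_window hN).1 hqm
  have hIcc : window N x h = Finset.Icc p q := by
    ext k
    rw [Finset.mem_Icc]
    refine ⟨fun hk => ⟨Finset.min'_le _ _ hk, Finset.le_max' _ _ hk⟩, fun ⟨h1, h2⟩ => ?_⟩
    have h1' : (p : ℝ) ≤ k := by exact_mod_cast h1
    have h2' : (k : ℝ) ≤ q := by exact_mod_cast h2
    exact (mem_window hN).2 ⟨hpm'.1.trans h1, h2.trans hqm'.2.1, hpm'.2.2.1.trans h1',
      h2'.trans hqm'.2.2.2⟩
  have hcard : localSize N x h = q + 1 - p := by rw [localSize, hIcc, Nat.card_Icc]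
  have hpn : p + localSize N x h = q + 1 := by omega
  refine ⟨p, hpm'.1, ?_, ?_, ?_⟩
  · rw [hpn, hIcc]
    ext k
    simp only [Finset.mem_Icc, Finset.mem_Ico]
    omega
  -- Otherwise `p - 1` would still lie to the right of `N * x` and belong to the window. The bound
  -- cannot be sharpened to `p ≤ N * x`: at `x = 0` the window starts at 1.
  · by_contra! hlt
    have hp2 : 1 < p := by
      have : (1 : ℝ) < p := by linarith
      exact_mod_cast this
    have hc : ((p - 1 : ℕ) : ℝ) = p - 1 := by rw [Nat.cast_sub hp2.le, Nat.cast_one]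
    have hmem : p - 1 ∈ window N x h := by
      refine (mem_window hN).2 ⟨by omega, by omega, ?_, ?_⟩
      · rw [hc]; linarith
      · rw [hc]; linarith [hpm'.2.2.2]
    have := Finset.min'_le _ _ hmem
    omega
  · by_contra! hlt
    have hlt' : ((q + 1 : ℕ) : ℝ) < N * x := by rw [← hpn]; exact_mod_cast hlt
    have hqN : q + 1 < N := by exact_mod_cast hlt'.trans_le hNx1
    have hmem : q + 1 ∈ window N x h := by
      refine (mem_window hN).2 ⟨by omega, hqN.le, ?_, ?_⟩
      · push_cast; linarith [hqm'.2.2.1]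
      · linarith
    have := Finset.le_max' _ _ hmem
    omega

/-- Affine substitution does not raise the degree, so the window can be rescaled to the grid `i /
n`. -/
theorem exists_localPoly_comp_affine {d : ℕ} (x : ℝ) (b : Fin (d + 1) → ℝ) (A B : ℝ) :
    ∃ b' : Fin (d + 1) → ℝ, ∀ t, localPoly 0 b' t = localPoly x b (A * t + B) := by
  let p : Polynomial ℝ := ∑ i : Fin (d + 1),
    Polynomial.C (b i) * (Polynomial.C A * Polynomial.X + Polynomial.C (B - x)) ^ (i : ℕ)
  have hdeg : p.natDegree < d + 1 := by
    refine Nat.lt_succ_iff.2 (Polynomial.natDegree_sum_le_of_forall_le _ _ fun i _ => ?_)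
    refine (Polynomial.natDegree_C_mul_le _ _).trans (Polynomial.natDegree_pow_le.trans ?_)
    have h1 := Polynomial.natDegree_linear_le (a := A) (b := B - x)
    have h2 := i.2
    nlinarith
  refine ⟨fun i => p.coeff i, fun t => ?_⟩
  have h1 := Polynomial.eval_eq_sum_range' hdeg t
  rw [localPoly, localPoly]
  simp only [sub_zero]
  rw [Fin.sum_univ_eq_sum_range (fun i => p.coeff i * t ^ i) (d + 1), ← h1]
  simp only [p, Polynomial.eval_finsetSum, Polynomial.eval_mul, Polynomial.eval_C,
    Polynomial.eval_pow, Polynomial.eval_add, Polynomial.eval_X]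
  refine Finset.sum_congr rfl fun i _ => ?_
  ring

theorem localPoly_sub {d : ℕ} (x : ℝ) (b c : Fin (d + 1) → ℝ) (y : ℝ) :
    localPoly x (b - c) y = localPoly x b y - localPoly x c y := by
  simp [localPoly, sub_mul, Finset.sum_sub_distrib]

theorem localPoly_single_zero {d : ℕ} (x B y : ℝ) :
    localPoly x (Pi.single (0 : Fin (d + 1)) B) y = B := by
  rw [localPoly, Finset.sum_eq_single 0]
  · simp
  · intro i _ hi; simp [hi]
  · simp

theorem localPoly_self {d : ℕ} (x : ℝ) (b : Fin (d + 1) → ℝ) : localPoly x b x = b 0 := by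
  rw [localPoly, Finset.sum_eq_single 0]
  · simp
  · intro i _ hi
    have : (i : ℕ) ≠ 0 := fun h => hi (Fin.ext h)
    simp [this]
  · simp

/-- Deterministic error bound for the estimator: the approximation error of the regression function
by polynomials, plus the largest over finitely many blocks of the smallest noise in the block. -/
theorem exists_abs_quasiMLE_sub_le (d : ℕ) :
    ∃ (K n₀ : ℕ) (C : ℝ), 0 < K ∧ 0 < C ∧ ∀ (N : ℕ) (x h : ℝ), 1 ≤ N → x ∈ Set.Icc (0 : ℝ) 1 →
      0 < h → 0 < localSize N x h → n₀ ≤ localSize N x h →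
      ∃ s : ℕ, 1 ≤ s ∧ window N x h = Finset.Ico s (s + localSize N x h) ∧
        ∀ (Y f : ℕ → ℝ) (c : Fin (d + 1) → ℝ) (B r t : ℝ), 0 ≤ B → 0 ≤ r →
          (∀ k ∈ window N x h, |f k - localPoly x c ((k : ℝ) / N)| ≤ B) →
          (∀ k ∈ window N x h, f k ≤ Y k) →
          (∀ j < K, ∃ i : ℕ, j * (localSize N x h / K) ≤ i ∧
            i < (j + 1) * (localSize N x h / K) ∧ Y (s + i) ≤ f (s + i) + r) →
          IsQuasiMLE d N x h Y t → |t - c 0| ≤ C * (B + r) := by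
  obtain ⟨K, n₀, C, hK, hC, hmain⟩ := exists_abs_localPoly_le_of_blocks d
  refine ⟨K, n₀, C, hK, hC, fun N x h hN hx hh hn0 hn => ?_⟩
  obtain ⟨s, hs1, hW, hsl, hsu⟩ := exists_window_eq_Ico hN hx hh hn0
  refine ⟨s, hs1, hW, ?_⟩
  generalize localSize N x h = n at *
  intro Y f c B r t hB hr hfc hfY hblock ⟨b, ⟨hfeas, hopt⟩, ht⟩
  have hNR : (0 : ℝ) < N := by exact_mod_cast hN
  have hnR : (0 : ℝ) < n := by exact_mod_cast hn0
  -- This map sends `i / n` to `(s + i) / N`, and `(N * x - s) / n` to `x`. The latter argument may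
  -- be negative, which is why the polynomial bound covers `|u| ≤ 1`.
  obtain ⟨b', hb'⟩ := exists_localPoly_comp_affine x (b - c) (n / N) (s / N)
  have hgrid : ∀ i : ℕ, localPoly 0 b' ((i : ℝ) / n) =
      localPoly x b (((s + i : ℕ) : ℝ) / N) - localPoly x c (((s + i : ℕ) : ℝ) / N) := by
    intro i
    rw [hb', localPoly_sub]
    have : (n : ℝ) / N * (i / n) + s / N = ((s + i : ℕ) : ℝ) / N := by
      push_cast
      field_simp
      ring
    rw [this]
  have hmem : ∀ i < n, s + i ∈ window N x h := by
    intro i hi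
    rw [hW, Finset.mem_Ico]
    omega
  have hres := hmain n hn b' (B + r) (by positivity) (fun j hj => by
      obtain ⟨i, hi1, hi2, hi⟩ := hblock j hj
      have hin : i < n :=
        hi2.trans_le ((Nat.mul_le_mul_right _ hj).trans (Nat.mul_div_le n K))
      refine ⟨i, hi1, hi2, ?_⟩
      rw [hgrid]
      linarith [hfeas _ (hmem i hin), (abs_le.1 (hfc _ (hmem i hin))).2])
    (by
      -- The Taylor polynomial lowered by `B` lies below `f`, hence below `Y`, and so competes in
      -- the linear program.
      have h1 := hopt (c - Pi.single 0 B) (fun k hk => by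
        rw [localPoly_sub, localPoly_single_zero]
        linarith [(abs_le.1 (hfc k hk)).1, hfY k hk])
      simp only [localPoly_sub, localPoly_single_zero] at h1
      rw [hW, Finset.sum_Ico_eq_sum_range, Finset.sum_Ico_eq_sum_range, Nat.add_sub_cancel_left,
        Finset.sum_sub_distrib, Finset.sum_const, Finset.card_range, nsmul_eq_mul] at h1
      simp only [hgrid]
      rw [Finset.sum_sub_distrib]
      nlinarith)
    ((N * x - s) / n) (by
      rw [abs_div, abs_of_pos hnR, div_le_one hnR, abs_le]
      have : (1 : ℝ) ≤ n := by exact_mod_cast hn0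
      constructor <;> linarith)
  rw [hb'] at hres
  have h2 : (n : ℝ) / N * ((N * x - s) / n) + s / N = x := by
    field_simp
    ring
  rwa [h2, localPoly_self, Pi.sub_apply, ← ht] at hres

/-! ### The probability bound. -/

theorem theorem1 {Ω : Type*} [MeasurableSpace Ω] (P : Measure Ω) [IsProbabilityMeasure P]
    (ε : ℤ → Ω → ℝ) (a β L ρ x : ℝ) (d : ℕ)
    (hε : InnovationAssumption P ε a)
    (hβ : 0 < β) (hL : 0 < L) (hρ : ρ < 1) (hx : x ∈ Set.Icc (0 : ℝ) 1)
    (hd : strictFloor β ≤ d) :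
    ∃ c₁ c₂ c₃ ν : ℝ, 0 < c₁ ∧ 0 < c₂ ∧ 0 < c₃ ∧ 0 < ν ∧
      ∀ (N : ℕ) (h v : ℝ), 1 ≤ N → 0 < h → 0 ≤ v → v ≤ (localSize N x h : ℝ) ^ ν →
        ∀ f : ℝ → ℝ, HolderClass L β f → (∀ y ∈ Set.Icc (0 : ℝ) 1, 0 ≤ f y ∧ f y ≤ ρ) →
          ∀ fhat : Ω → ℝ, (∀ᵐ ω ∂P, IsQuasiMLE d N x h (response N f ε ω) (fhat ω)) →
            P.real {ω | c₁ * h ^ β + c₂ * (localSize N x h : ℝ) ^ (-(1 / a)) * v ≤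
                |fhat ω - f x|} ≤ c₃ * Real.exp (-(v ^ a)) := by
  have ha := hε.shape_pos
  obtain ⟨K, n₀, C, hK, hC, hdet⟩ := exists_abs_quasiMLE_sub_le d
  obtain ⟨κ, r₀, hκ, hr₀, hprob⟩ := hε.exists_measureReal_forall_pairs_le
  have hKR : (0 : ℝ) < K := by exact_mod_cast hK
  -- Chosen so that `κ * r ^ a * M ≥ v ^ a`, given `n ≤ 4 * K * M`.
  set w : ℝ := (4 * K / κ) ^ (1 / a) with hw
  have hw0 : 0 < w := by positivity
  have hwa : w ^ a = 4 * K / κ := by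
    rw [hw, ← Real.rpow_mul (by positivity), one_div_mul_cancel ha.ne', Real.rpow_one]
  have hlim : Tendsto (fun n : ℕ => w * (n : ℝ) ^ (-(1 / (2 * a)))) atTop (𝓝 0) := by
    simpa using ((tendsto_rpow_neg_atTop (show 0 < 1 / (2 * a) by positivity)).comp
      tendsto_natCast_atTop_atTop).const_mul w
  obtain ⟨n₁, hn₁⟩ := eventually_atTop.1 (hlim.eventually (eventually_le_nhds hr₀))
  set n₂ : ℕ := max n₀ (max n₁ (2 * K)) with hn₂
  -- With this exponent `r ≤ w * n ^ (-ν)`, which drops below `r₀` for large `n`, where the tail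
  -- estimate applies.
  set ν : ℝ := 1 / (2 * a) with hν
  have hν0 : 0 < ν := by positivity
  -- The `+ 1` makes the deterministic bound strictly smaller than the threshold, as `h ^ β > 0`.
  -- The exponential term in the third constant makes the claim trivial for `n < n₂`, including `n =
  -- 0`.
  refine ⟨C * L + 1, C * w, K + Real.exp (((n₂ : ℝ) ^ ν) ^ a), ν, by positivity, by positivity,
    by positivity, hν0, ?_⟩
  intro N h v hN hh hv hvn f hf hfρ fhat hfhat
  rcases lt_or_ge (localSize N x h) n₂ with hlt | hge
  · refine measureReal_le_one.trans ?_
    have h1 : v ^ a ≤ ((n₂ : ℝ) ^ ν) ^ a := by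
      have h2 : ((localSize N x h : ℕ) : ℝ) ≤ n₂ := by exact_mod_cast hlt.le
      have h3 : v ≤ (n₂ : ℝ) ^ ν := hvn.trans (by gcongr)
      gcongr
    have h4 : 1 ≤ Real.exp (((n₂ : ℝ) ^ ν) ^ a) * Real.exp (-(v ^ a)) := by
      rw [← Real.exp_add]
      exact Real.one_le_exp (by linarith)
    have h5 : 0 ≤ K * Real.exp (-(v ^ a)) := by positivity
    rw [add_mul]
    linarith
  have hK2 : 2 * K ≤ localSize N x h := ((le_max_right _ _).trans (le_max_right _ _)).trans hge
  have hpos : 0 < localSize N x h := by omega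
  obtain ⟨s, hs1, hW, hbound⟩ := hdet N x h hN hx hh hpos ((le_max_left _ _).trans hge)
  have hn1 := hn₁ _ (((le_max_left _ _).trans (le_max_right _ _)).trans hge)
  generalize localSize N x h = n at *
  have hnR : (0 : ℝ) < n := by exact_mod_cast hpos
  set r : ℝ := w * (n : ℝ) ^ (-(1 / a)) * v with hr
  have hr0 : 0 ≤ r := by positivity
  have hrr₀ : r ≤ r₀ := by
    refine le_trans ?_ hn1
    rw [hr, mul_assoc]
    refine mul_le_mul_of_nonneg_left ?_ hw0.le
    calc (n : ℝ) ^ (-(1 / a)) * v ≤ (n : ℝ) ^ (-(1 / a)) * (n : ℝ) ^ ν := by gcongr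
      _ = (n : ℝ) ^ (-ν) := by
        rw [← Real.rpow_add hnR, hν]
        congr 1
        field_simp
        ring
  set m : ℕ := n / K with hm
  set M : ℕ := m / 2 with hM
  have hrM : v ^ a ≤ κ * r ^ a * M := by
    have h1 : r ^ a = 4 * K / κ * (n : ℝ)⁻¹ * v ^ a := by
      rw [hr, Real.mul_rpow (by positivity) hv, Real.mul_rpow hw0.le (by positivity), hwa,
        ← Real.rpow_mul hnR.le, neg_mul, one_div_mul_cancel ha.ne', Real.rpow_neg_one]
    have h2 : (n : ℝ) ≤ 4 * K * M := by
      have e1 : M = n / (K * 2) := by rw [hM, hm, Nat.div_div_eq_div_mul]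
      have e2 : 1 ≤ M := by
        rw [e1, Nat.le_div_iff_mul_le (by positivity)]
        linarith
      have e3 : n < M * (K * 2) + K * 2 := by
        rw [e1]
        exact Nat.lt_div_mul_add (by positivity)
      have e4 : n ≤ 4 * K * M := by nlinarith
      exact_mod_cast e4
    rw [h1]
    calc v ^ a = (n : ℝ) * ((n : ℝ)⁻¹ * v ^ a) := by field_simp
      _ ≤ 4 * K * M * ((n : ℝ)⁻¹ * v ^ a) := by gcongr
      _ = _ := by field_simp
  -- Block `j` fails: none of its `M` disjoint pairs has ratio at most `r`. The second member of a
  -- pair, at odd offset, is the observed index.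
  let E : ℕ → Set Ω := fun j => {ω | ∀ l < M, r * ε (((s + j * m : ℕ) : ℤ) + (2 * l : ℕ)) ω <
    ε (((s + j * m : ℕ) : ℤ) + (2 * l + 1 : ℕ)) ω}
  have hE : ∀ j, P.real (E j) ≤ Real.exp (-(v ^ a)) := fun j =>
    (hprob _ M r hr0 hrr₀).trans (Real.exp_le_exp.2 (neg_le_neg hrM))
  obtain ⟨c, hc0, hc⟩ := hf.exists_localPoly hβ hx hd
  have hsub : ∀ᵐ ω ∂P, ω ∈ {ω | (C * L + 1) * h ^ β + C * w * (n : ℝ) ^ (-(1 / a)) * v ≤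
      |fhat ω - f x|} → ω ∈ ⋃ j ∈ Finset.range K, E j := by
    filter_upwards [hfhat, hε.ae_response_bounds hρ hfρ N] with ω hω hresp
    intro hbig
    by_contra hnot
    simp only [Set.mem_iUnion, Finset.mem_range, not_exists] at hnot
    have hwin : ∀ k ∈ window N x h, k ≤ N ∧ (k : ℝ) / N ∈ Set.Icc (0 : ℝ) 1 ∧
        |(k : ℝ) / N - x| ≤ h := by
      intro k hk
      obtain ⟨h1, h2⟩ := Finset.mem_filter.1 hk
      have h3 := (Finset.mem_Icc.1 h1).2
      exact ⟨h3, ⟨by positivity, div_le_one_of_le₀ (by exact_mod_cast h3) (by positivity)⟩, h2⟩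
    have hfin := hbound (response N f ε ω) (fun k => f ((k : ℝ) / N)) c (L * h ^ β) r (fhat ω)
      (by positivity) hr0
      (fun k hk => by
        obtain ⟨-, h2, h3⟩ := hwin k hk
        refine (hc _ h2).trans ?_
        gcongr)
      (fun k hk => (hresp k (hwin k hk).1).1)
      (fun j hj => by
        have h1 := hnot j hj
        simp only [E, Set.mem_ofPred_eq, not_forall, not_lt] at h1
        obtain ⟨l, hl, hle⟩ := h1
        have hi : j * m + (2 * l + 1) < (j + 1) * m := by
          rw [add_mul, one_mul]
          omega
        have hin : j * m + (2 * l + 1) < n :=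
          hi.trans_le ((Nat.mul_le_mul_right _ hj).trans (Nat.mul_div_le n K))
        refine ⟨j * m + (2 * l + 1), by omega, hi, ?_⟩
        have hmem : s + (j * m + (2 * l + 1)) ∈ window N x h := by
          rw [hW, Finset.mem_Ico]
          omega
        refine (hresp _ (hwin _ hmem).1).2 r hr0 ?_
        have e1 : ((s + (j * m + (2 * l + 1)) : ℕ) : ℤ) =
            ((s + j * m : ℕ) : ℤ) + (2 * l + 1 : ℕ) := by push_cast; ring
        have e2 : ((s + (j * m + (2 * l + 1)) : ℕ) : ℤ) - 1 =
            ((s + j * m : ℕ) : ℤ) + (2 * l : ℕ) := by push_cast; ring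
        rw [e2, e1]
        exact hle)
      hω
    rw [hc0] at hfin
    have hbig' : (C * L + 1) * h ^ β + C * w * (n : ℝ) ^ (-(1 / a)) * v ≤ |fhat ω - f x| := hbig
    have hhβ : 0 < h ^ β := by positivity
    have e1 : C * w * (n : ℝ) ^ (-(1 / a)) * v = C * r := by rw [hr]; ring
    rw [e1] at hbig'
    nlinarith
  -- Monotonicity of the outer measure suffices, so `fhat` need not be measurable.
  have hmono : P.real {ω | (C * L + 1) * h ^ β + C * w * (n : ℝ) ^ (-(1 / a)) * v ≤
      |fhat ω - f x|} ≤ P.real (⋃ j ∈ Finset.range K, E j) :=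
    ENNReal.toReal_mono (measure_ne_top _ _) (measure_mono_ae hsub)
  calc _ ≤ _ := hmono
    _ ≤ ∑ j ∈ Finset.range K, P.real (E j) := measureReal_biUnion_finset_le _ _
    _ ≤ ∑ j ∈ Finset.range K, Real.exp (-(v ^ a)) := Finset.sum_le_sum fun j _ => hE j
    _ = K * Real.exp (-(v ^ a)) := by simp
    _ ≤ _ := by gcongr; linarith [Real.exp_pos (((n₂ : ℝ) ^ ν) ^ a)]
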